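/- **Conventions.** Let $\mathbb K\in\{\mathbb R,\mathbb C\}$. For a locally convex Hausdorff space $X$ let $X'$ be its topological dual, $X_b'$ the dual with the topology of uniform convergence on bounded sets, and call $X$ *bornological* if every absolutely convex set absorbing all bounded sets is a $0$-neighbourhood, *semi-reflexive* if the evaluation map $X\to (X_b')'$ is surjective, and *semi-Montel* if every bounded subset of $X$ is relatively compact. For topologies, $\tau_0\le\tau_1$ means that $\tau_0$ is coarser than $\tau_1$. Topological isomorphisms are linear homeomorphisms. Let $\tau,\widetilde\tau$ be locally convex Hausdorff topologies on a $\mathbb K$-vector space $X$, and $\mathcal B$ the family of $\tau$-bounded sets. We say that $(X,\tau)$ satisfies, for $\widetilde\tau$, * (BBC) if every $\tau$-bounded set is contained in an absolutely convex $\tau$-bounded $\widetilde\tau$-compact set; * (BBCl) if every $\tau$-bounded set is contained in an absolutely convex $\tau$-bounded $\widetilde\tau$-closed set; * (CNC) if $\tau$ has a $0$-neighbourhood basis of absolutely convex $\widetilde\tau$-closed sets. Let $\widetilde\gamma=\widetilde\gamma(\tau,\widetilde\tau)$ be the finest locally convex Hausdorff topology on $X$ which coincides with $\widetilde\tau$ on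 all $\tau$-bounded sets; $(X,\widetilde\gamma)$ satisfies (B$\tau$B$\widetilde\gamma$) if a subset of $X$ is $\tau$-bounded if and only if it is $\widetilde\gamma$-bounded. Let $X'_{\mathcal B,\widetilde\tau}$ be the space of all linear functionals $X\to\mathbb K$ whose restriction to every $B\in\mathcal B$ is $\widetilde\tau$-continuous. **Theorem.** Let $(\mathcal F,\tau)$ be a bornological locally convex Hausdorff space of $\mathbb K$-valued functions on a non-empty set $\Omega$ (a linear subspace $\mathcal F$ of $\mathbb K^\Omega$ with a bornological locally convex Hausdorff topology $\tau$), $\mathcal B$ the family of $\tau$-bounded sets, $\tau_{\mathrm p}$ the topology of pointwise convergence on $\mathcal F$, and $\delta_x(f):=f(x)$ for $f\in\mathcal F$, $x\in\Omega$. In the following, $\widetilde\tau$ always denotes a locally convex Hausdorff topology on $\mathcal F$. The following assertions are equivalent. (a) $(\mathcal F,\tau)$ admits a strong complete barrelled linearisation, i.e. there are a complete barrelled locally convex Hausdorff space $Y$ over $\mathbb K$, a map $\delta\colon\Omega\to Y$ and a topological isomorphism $T\colon(\mathcal F,\tau)\to Y_b'$ such that $T(f)\circ\delta=f$ for all $f\in\mathcal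 F$. (b) There are a semi-Montel locally convex Hausdorff space $Y$ over $\mathbb K$ such that $Y_b'$ is complete and a topological isomorphism $\varphi\colon(\mathcal F,\tau)\to(Y_b')_b'$ such that for every $x\in\Omega$ there is a unique $y_x'\in Y'$ with $\delta_x=\varphi(\cdot)(y_x')$. (c) $(\mathcal F,\tau)$ satisfies (BBC) and (CNC) for some $\widetilde\tau$ such that $\tau_{\mathrm p}\le\widetilde\tau$ and $(\mathcal F,\widetilde\gamma)$ satisfies (B$\tau$B$\widetilde\gamma$). (d) $(\mathcal F,\tau)$ satisfies (BBCl) and (CNC) for some $\widetilde\tau$ such that $\tau_{\mathrm p}\le\widetilde\tau$ and $(\mathcal F,\widetilde\gamma)$ is semi-reflexive and satisfies (B$\tau$B$\widetilde\gamma$). (e) $(\mathcal F,\tau)$ satisfies (BBC) and (CNC) for some $\widetilde\tau$ such that $\tau_{\mathrm p}\le\widetilde\tau$. (f) $(\mathcal F,\tau)$ satisfies (BBC) and (CNC) for some $\widetilde\tau$ such that $\delta_x\in\mathcal F'_{\mathcal B,\widetilde\tau}$ for all $x\in\Omega$. -/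

import Mathlib

open scoped ComplexOrder Topology

universe u v w

namespace LCLin

section Spaces

variable (𝕜 : Type v) [RCLike 𝕜] {X : Type*} [AddCommGroup X] [Module 𝕜 X]

/-- `τ` is a locally convex Hausdorff topology on the `𝕜`-vector space `X`. -/
structure IsLCHausdorff (τ : TopologicalSpace X) : Prop where
  isTopologicalAddGroup : @IsTopologicalAddGroup X τ _
  continuousSMul : @ContinuousSMul 𝕜 X _ _ τ
  locallyConvexSpace : @LocallyConvexSpace 𝕜 X _ _ _ _ τ
  t2Space : @T2Space X τ

/-- `B` is `τ`-bounded. -/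
abbrev IsBdd (τ : TopologicalSpace X) (B : Set X) : Prop :=
  @Bornology.IsVonNBounded 𝕜 X _ _ _ τ B

/-- `(X, τ)` is bornological: every absolutely convex set which absorbs all `τ`-bounded sets is
a `τ`-neighbourhood of zero. -/
def IsBornological (τ : TopologicalSpace X) : Prop :=
  ∀ U : Set X, AbsConvex 𝕜 U → (∀ B, IsBdd 𝕜 τ B → Absorbs 𝕜 U B) → U ∈ @nhds X τ 0

/-- `(X, τ)` is semi-reflexive: every continuous linear functional on the strong dual of `(X, τ)`
is the evaluation at a point of `X`. -/
def IsSemiReflexive (τ : TopologicalSpace X) : Prop :=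
  ∀ u : StrongDual 𝕜 (StrongDual 𝕜 X), ∃ x : X, ∀ x' : StrongDual 𝕜 X, u x' = x' x

/-- (BBC) for `τt`: every `τ`-bounded set is contained in an absolutely convex `τ`-bounded
`τt`-compact set. -/
def BBC (τ τt : TopologicalSpace X) : Prop :=
  ∀ B, IsBdd 𝕜 τ B → ∃ C, B ⊆ C ∧ AbsConvex 𝕜 C ∧ IsBdd 𝕜 τ C ∧ @IsCompact X τt C

/-- (BBCl) for `τt`: every `τ`-bounded set is contained in an absolutely convex `τ`-bounded
`τt`-closed set. -/
def BBCl (τ τt : TopologicalSpace X) : Prop :=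
  ∀ B, IsBdd 𝕜 τ B → ∃ C, B ⊆ C ∧ AbsConvex 𝕜 C ∧ IsBdd 𝕜 τ C ∧ IsClosed[τt] C

/-- (CNC) for `τt`: `τ` has a basis of neighbourhoods of zero consisting of absolutely convex
`τt`-closed sets. -/
def CNC (τ τt : TopologicalSpace X) : Prop :=
  ∃ U₀ : Set (Set X), (∀ U ∈ U₀, AbsConvex 𝕜 U ∧ IsClosed[τt] U) ∧
    (@nhds X τ 0).HasBasis (fun U => U ∈ U₀) id

/-- The locally convex Hausdorff topologies on `X` which coincide with `τt` on all `τ`-bounded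
sets. -/
def mixedTopologies (τ τt : TopologicalSpace X) : Set (TopologicalSpace X) :=
  {σ | IsLCHausdorff 𝕜 σ ∧ ∀ B, IsBdd 𝕜 τ B →
    TopologicalSpace.induced ((↑) : B → X) σ = TopologicalSpace.induced ((↑) : B → X) τt}

/-- The finest locally convex Hausdorff topology on `X` which coincides with `τt` on all
`τ`-bounded sets (in the order of `TopologicalSpace X`, finer means smaller); that it is a member
of `mixedTopologies` is `isLeast_gammaTilde`. -/
@[reducible] def gammaTilde (τ τt : TopologicalSpace X) : TopologicalSpace X :=
  sInf (mixedTopologies 𝕜 τ τt)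

theorem isLeast_gammaTilde (τ τt : TopologicalSpace X) (h : IsLCHausdorff 𝕜 τt) :
    IsLeast (mixedTopologies 𝕜 τ τt) (gammaTilde 𝕜 τ τt) := by
  have hmem : τt ∈ mixedTopologies 𝕜 τ τt := ⟨h, fun _ _ => rfl⟩
  refine ⟨⟨⟨?_, ?_, ?_, ?_⟩, ?_⟩, fun σ hσ => sInf_le hσ⟩
  · exact topologicalAddGroup_sInf fun σ hσ => hσ.1.isTopologicalAddGroup
  · exact continuousSMul_sInf fun σ hσ => hσ.1.continuousSMul
  · have : ∀ σ ∈ mixedTopologies 𝕜 τ τt, @IsTopologicalAddGroup X σ _ :=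
      fun σ hσ => hσ.1.isTopologicalAddGroup
    exact LocallyConvexSpace.sInf fun σ hσ => hσ.1.locallyConvexSpace
  · exact t2Space_antitone (sInf_le hmem) h.t2Space
  · intro B hB
    apply le_antisymm
    · exact induced_mono (sInf_le hmem)
    · rw [gammaTilde, sInf_eq_iInf, induced_iInf]
      refine le_iInf fun σ => ?_
      rw [induced_iInf]
      exact le_iInf fun hσ => (hσ.2 B hB).ge

/-- (BτBγ): the `τ`-bounded sets are exactly the `γ`-bounded sets. -/
def SameBounded (τ γ : TopologicalSpace X) : Prop :=
  ∀ B : Set X, IsBdd 𝕜 τ B ↔ IsBdd 𝕜 γ B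

/-- The space of linear functionals on `X` whose restriction to every `τ`-bounded set is
`τt`-continuous. -/
def boundedDual (τ τt : TopologicalSpace X) : Submodule 𝕜 (Module.Dual 𝕜 X) where
  carrier := {u | ∀ B, IsBdd 𝕜 τ B → @ContinuousOn X 𝕜 τt _ u B}
  add_mem' hu hv B hB := by
    let _ : TopologicalSpace X := τt
    exact ContinuousOn.add (hu B hB) (hv B hB)
  zero_mem' B _ := by
    let _ : TopologicalSpace X := τt
    exact continuousOn_const
  smul_mem' c u hu B hB := by
    let _ : TopologicalSpace X := τt
    exact ContinuousOn.const_smul (hu B hB) c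

end Spaces

section FunctionSpaces

variable {𝕜 : Type v} [RCLike 𝕜] {Ω : Type u}

/-- The topology of pointwise convergence on a space of functions. -/
@[reducible] def pointwiseTopology (F : Submodule 𝕜 (Ω → 𝕜)) : TopologicalSpace F :=
  TopologicalSpace.induced (fun f => (f : Ω → 𝕜)) Pi.topologicalSpace

/-- The point evaluation `δ_x`. -/
def pointEval (F : Submodule 𝕜 (Ω → 𝕜)) (x : Ω) : Module.Dual 𝕜 F :=
  (LinearMap.proj x).comp F.subtype

/-- `(δ, Y, T)` is a strong linearisation of `(F, τ)`: the linear bijection `T` is a topological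
isomorphism onto the strong dual of `Y`, and `T(f) ∘ δ = f` for all `f ∈ F`. -/
def IsStrongLinearisation (F : Submodule 𝕜 (Ω → 𝕜)) (τ : TopologicalSpace F)
    {Y : Type*} [AddCommGroup Y] [Module 𝕜 Y] [TopologicalSpace Y]
    (δ : Ω → Y) (T : F ≃ₗ[𝕜] StrongDual 𝕜 Y) : Prop :=
  @IsHomeomorph F (StrongDual 𝕜 Y) τ _ T ∧ ∀ f : F, (T f : Y → 𝕜) ∘ δ = (f : Ω → 𝕜)

/-- `(F, τ)` admits a strong linearisation `(δ, Y, T)` with a complete barrelled locally convex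
Hausdorff space `Y`. The universe `w` is arbitrary. -/
def AdmitsStrongCompleteBarrelledLinearisation (F : Submodule 𝕜 (Ω → 𝕜))
    (τ : TopologicalSpace F) : Prop :=
  ∃ (Y : Type (max u v w)) (_ : AddCommGroup Y) (_ : Module 𝕜 Y) (uY : UniformSpace Y)
    (_ : IsUniformAddGroup Y),
    IsLCHausdorff 𝕜 uY.toTopologicalSpace ∧ CompleteSpace Y ∧ BarrelledSpace 𝕜 Y ∧
    ∃ (δ : Ω → Y) (T : F ≃ₗ[𝕜] StrongDual 𝕜 Y), IsStrongLinearisation F τ δ T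

/-- `(F, τ)` has a semi-Montel prebidual `(Y, φ)` with complete strong dual `Y'`, such that every
point evaluation is of the form `f ↦ φ(f)(y')` for a unique `y' ∈ Y'`. Mathlib's `MontelSpace` does
not include barrelledness, so it is the notion of a semi-Montel space. The universe `w` is
arbitrary. -/
def HasSemiMontelPrebidualWithEvaluations (F : Submodule 𝕜 (Ω → 𝕜))
    (τ : TopologicalSpace F) : Prop :=
  ∃ (Y : Type (max u v w)) (_ : AddCommGroup Y) (_ : Module 𝕜 Y) (tY : TopologicalSpace Y),
    IsLCHausdorff 𝕜 tY ∧ MontelSpace 𝕜 Y ∧ CompleteSpace (StrongDual 𝕜 Y) ∧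
    ∃ φ : F ≃ₗ[𝕜] StrongDual 𝕜 (StrongDual 𝕜 Y),
      @IsHomeomorph F (StrongDual 𝕜 (StrongDual 𝕜 Y)) τ _ φ ∧
      ∀ x : Ω, ∃! y' : StrongDual 𝕜 Y, ∀ f : F, pointEval F x f = φ f y'

end FunctionSpaces

end LCLin

open Topology (IsEmbedding IsInducing)

namespace LCLin

/-! ### Absolutely convex sets, polars and the bipolar theorem. -/

section Convexity

variable {𝕜 : Type*} [RCLike 𝕜] {X : Type*} [AddCommGroup X] [Module 𝕜 X]

/-! The prebidual is `F` itself with the topology γ̃, and the predual is the strong dual of `(F,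
γ̃)`. Assertion (e) is the hub: the other conditions are obtained from it or reduced to it.

Starting from (e), adjoining to τ̃ a functional that is τ̃-continuous on bounded sets does not
change τ̃ on those sets. So the γ̃-continuous functionals are exactly the functionals with this
property (`mem_boundedDual_iff`), and they are stable under uniform limits on τ-bounded sets. By a
uniform boundedness argument on ℓ¹, this stability makes γ̃-bounded sets τ-bounded
(`sameBounded_gammaTilde`), and it then makes the strong dual of `(F, γ̃)` complete
(`completeSpace_strongDual`). Now (BBC) makes `(F, γ̃)` semi-Montel, hence semi-reflexive. By
Hahn-Banach, (CNC) turns τ-neighbourhoods into prepolars of strongly bounded sets of functionals,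
and bornologicity gives the reverse comparison. So τ is the strong bidual topology
(`isHomeomorph_evalBidual`), which gives (b). The strong dual of a semi-reflexive space is barrelled
(`barrelledSpace_strongDual`), which gives (a) with δ sending points to point evaluations.

Conversely, a barrelled predual yields (e) with its weak* topology, by Banach-Steinhaus and Alaoglu.
Under (d), the weak topology of γ̃ serves instead, because semi-reflexivity makes bipolars of
bounded sets weakly compact. Finally, (f) reduces to (e) by joining τ̃ with the pointwise topology.
-/

theorem locallyConvexSpace_iff_real [Module ℝ X] [IsScalarTower ℝ 𝕜 X] [TopologicalSpace X] :
    LocallyConvexSpace 𝕜 X ↔ LocallyConvexSpace ℝ X := by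
  constructor <;> intro h <;> refine ⟨fun x => ?_⟩
  · simpa only [convex_RCLike_iff_convex_real (K := 𝕜)] using h.convex_basis x
  · simpa only [convex_RCLike_iff_convex_real (K := 𝕜)] using h.convex_basis x

instance locallyConvexSpace_self : LocallyConvexSpace 𝕜 𝕜 :=
  locallyConvexSpace_iff_real.2 inferInstance

theorem absConvex_setOf_forall_norm_le (M : Set (Module.Dual 𝕜 X)) :
    AbsConvex 𝕜 {x | ∀ v ∈ M, ‖v x‖ ≤ 1} := by
  let _ : Module ℝ X := Module.compHom X (algebraMap ℝ 𝕜)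
  have : IsScalarTower ℝ 𝕜 X := IsScalarTower.of_algebraMap_smul fun _ _ => rfl
  refine ⟨?_, ?_⟩
  · rintro a ha _ ⟨x, hx, rfl⟩ v hv
    simpa using mul_le_one₀ ha (norm_nonneg _) (hx v hv)
  · rw [convex_RCLike_iff_convex_real (K := 𝕜)]
    intro x hx y hy a b ha hb hab v hv
    have h1 : v (a • x + b • y) = (a : 𝕜) * v x + (b : 𝕜) * v y := by
      rw [map_add, ← algebraMap_smul 𝕜 a x, ← algebraMap_smul 𝕜 b y, map_smul, map_smul]
      simp
    rw [h1]
    calc _ ≤ ‖(a : 𝕜) * v x‖ + ‖(b : 𝕜) * v y‖ := norm_add_le _ _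
      _ = a * ‖v x‖ + b * ‖v y‖ := by simp [abs_of_nonneg ha, abs_of_nonneg hb]
      _ ≤ a * 1 + b * 1 := by gcongr <;> [exact hx v hv; exact hy v hv]
      _ = 1 := by linarith

theorem _root_.Balanced.absorbs_iff_exists_inv_smul_mem {U B : Set X} (hU : Balanced 𝕜 U) :
    Absorbs 𝕜 U B ↔ ∃ r : ℝ, 0 < r ∧ ∀ x ∈ B, ((r : 𝕜)⁻¹) • x ∈ U := by
  constructor
  · intro h
    obtain ⟨r, hr, h⟩ := h.exists_pos
    refine ⟨r, hr, fun x hx => ?_⟩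
    have hr' : (r : 𝕜) ≠ 0 := by exact_mod_cast hr.ne'
    exact (Set.mem_smul_set_iff_inv_smul_mem₀ hr' _ _).1
      (h (r : 𝕜) (by simp [abs_of_pos hr]) hx)
  · rintro ⟨r, hr, h⟩
    refine Absorbs.of_norm ⟨r, fun c hc x hx => ?_⟩
    have hc' : 0 < ‖c‖ := hr.trans_le hc
    rw [Set.mem_smul_set_iff_inv_smul_mem₀ (norm_pos_iff.1 hc')]
    have hr' : (r : 𝕜) ≠ 0 := by exact_mod_cast hr.ne'
    have := hU.smul_mem (a := c⁻¹ * r) (by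
      rw [norm_mul, norm_inv, RCLike.norm_ofReal, abs_of_pos hr, inv_mul_le_iff₀ hc']
      simpa using hc) (h x hx)
    rwa [smul_smul, mul_assoc, mul_inv_cancel₀ hr', mul_one] at this

/-- The neighbourhoods below are (pre)polars, so this turns boundedness into a uniform estimate on a
product of sets, symmetric in points and functionals. -/
theorem absorbs_setOf_forall_norm_le_iff {M : Set (Module.Dual 𝕜 X)} {B : Set X} :
    Absorbs 𝕜 {x | ∀ v ∈ M, ‖v x‖ ≤ 1} B ↔ ∃ r : ℝ, ∀ x ∈ B, ∀ v ∈ M, ‖v x‖ ≤ r := by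
  rw [(absConvex_setOf_forall_norm_le M).1.absorbs_iff_exists_inv_smul_mem]
  constructor
  · rintro ⟨r, hr, h⟩
    refine ⟨r, fun x hx v hv => ?_⟩
    have := h x hx v hv
    rwa [map_smul, smul_eq_mul, norm_mul, norm_inv, RCLike.norm_ofReal, abs_of_pos hr,
      inv_mul_le_iff₀ hr, mul_one] at this
  · rintro ⟨r, h⟩
    have hr : 0 < max r 1 := by positivity
    refine ⟨max r 1, hr, fun x hx v hv => ?_⟩
    rw [map_smul, smul_eq_mul, norm_mul, norm_inv, RCLike.norm_ofReal, abs_of_pos hr,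
      inv_mul_le_iff₀ hr, mul_one]
    exact (h x hx v hv).trans (le_max_left _ _)

/-- A closed absolutely convex set is separated from each point outside of it by a continuous
linear functional which is bounded by one on the set. -/
theorem exists_strongDual_norm_le_one_lt [TopologicalSpace X] [IsTopologicalAddGroup X]
    [ContinuousSMul 𝕜 X] [LocallyConvexSpace 𝕜 X] {C : Set X} (hC : AbsConvex 𝕜 C)
    (hcl : IsClosed C) (hne : C.Nonempty) {x : X} (hx : x ∉ C) :
    ∃ f : StrongDual 𝕜 X, (∀ a ∈ C, ‖f a‖ ≤ 1) ∧ 1 < ‖f x‖ := by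
  let _ : Module ℝ X := Module.compHom X (algebraMap ℝ 𝕜)
  have : IsScalarTower ℝ 𝕜 X := IsScalarTower.of_algebraMap_smul fun _ _ => rfl
  have : LocallyConvexSpace ℝ X := (locallyConvexSpace_iff_real (𝕜 := 𝕜)).1 inferInstance
  obtain ⟨f, s, hs, hsx⟩ := RCLike.geometric_hahn_banach_closed_point (𝕜 := 𝕜)
    ((convex_RCLike_iff_convex_real (K := 𝕜)).1 hC.2) hcl hx
  have hs0 : 0 < s := by
    have := hs 0 (hC.1.zero_mem hne)
    simpa using this
  have hs0' : (s : 𝕜) ≠ 0 := by exact_mod_cast hs0.ne'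
  refine ⟨(s : 𝕜)⁻¹ • f, fun a ha => ?_, ?_⟩
  -- Rotating `a` inside the balanced set upgrades the bound on the real part to a bound on the
  -- modulus.
  · obtain ⟨c, hc, hca⟩ := RCLike.exists_norm_eq_mul_self (f a)
    have := hs (c • a) (hC.1.smul_mem hc.le ha)
    rw [map_smul, smul_eq_mul, ← hca, RCLike.ofReal_re] at this
    rw [_root_.smul_apply, smul_eq_mul, norm_mul, norm_inv, RCLike.norm_ofReal,
      abs_of_pos hs0, inv_mul_le_iff₀ hs0]
    linarith
  · rw [_root_.smul_apply, smul_eq_mul, norm_mul, norm_inv, RCLike.norm_ofReal,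
      abs_of_pos hs0, lt_inv_mul_iff₀ hs0, mul_one]
    exact hsx.trans_le (RCLike.re_le_norm _)

theorem locallyConvexSpace_weakBilin {E V : Type*} [AddCommGroup E] [Module 𝕜 E]
    [AddCommGroup V] [Module 𝕜 V] (p : E →ₗ[𝕜] V →ₗ[𝕜] 𝕜) :
    LocallyConvexSpace 𝕜 (WeakBilin p) := by
  let q : WeakBilin p →ₗ[𝕜] V → 𝕜 :=
    { toFun := fun f v => p f v
      map_add' := fun f g => by ext v; exact congrArg (· v) (map_add p f g)
      map_smul' := fun c f => by ext v; exact congrArg (· v) (map_smul p c f) }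
  exact LocallyConvexSpace.induced (𝕜 := 𝕜) q

/-- The image of `C` is compact, hence closed, in the weak topology. A point outside it could be
separated by a continuous functional, and every such functional is pairing with some `v`. -/
theorem exists_mem_eq_of_mem_bipolar_weakBilin {E V : Type*} [AddCommGroup E] [Module 𝕜 E]
    [AddCommGroup V] [Module 𝕜 V] (p : E →ₗ[𝕜] V →ₗ[𝕜] 𝕜) (hp : Function.Injective p)
    [TopologicalSpace X] (j : X →ₗ[𝕜] WeakBilin p) {C : Set X} (hC : AbsConvex 𝕜 C)
    (hne : C.Nonempty) (hcomp : IsCompact C) (hj : ∀ v, ContinuousOn (fun x => p (j x) v) C)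
    (φ : WeakBilin p) (hφ : ∀ v, (∀ x ∈ C, ‖p (j x) v‖ ≤ 1) → ‖p φ v‖ ≤ 1) :
    ∃ x ∈ C, j x = φ := by
  have hp : IsEmbedding (fun (f : WeakBilin p) v => p f v) := WeakBilin.isEmbedding hp
  have : T2Space (WeakBilin p) := hp.t2Space
  have hlc : LocallyConvexSpace 𝕜 (WeakBilin p) := locallyConvexSpace_weakBilin p
  have hK : IsCompact (j '' C) := hcomp.image_of_continuousOn <|
    hp.isInducing.continuousOn_iff.2 (continuousOn_pi.2 hj)
  have hconv : AbsConvex 𝕜 (j '' C) := by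
    refine ⟨?_, hC.2.linear_image j⟩
    rintro a ha _ ⟨_, ⟨x, hx, rfl⟩, rfl⟩
    exact ⟨a • x, hC.1.smul_mem ha hx, map_smul _ _ _⟩
  by_contra hcon
  obtain ⟨f, hf, hfφ⟩ := exists_strongDual_norm_le_one_lt hconv hK.isClosed (hne.image _)
    (x := φ) (by rintro ⟨x, hx, h⟩; exact hcon ⟨x, hx, h⟩)
  obtain ⟨v, rfl⟩ := LinearMap.dualEmbedding_surjective p f
  exact absurd (hφ v fun x hx => hf _ ⟨x, hx, rfl⟩) (not_le.2 hfφ)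

/-- A linear functional in the bipolar of a compact absolutely convex set is the evaluation at a
point of this set. -/
theorem exists_mem_eq_of_mem_bipolar {V : Type*} [AddCommGroup V] [Module 𝕜 V]
    [TopologicalSpace X] (ι : X →ₗ[𝕜] Module.Dual 𝕜 V) {C : Set X} (hC : AbsConvex 𝕜 C)
    (hne : C.Nonempty) (hcomp : IsCompact C) (hι : ∀ v, ContinuousOn (fun x => ι x v) C)
    (φ : Module.Dual 𝕜 V) (hφ : ∀ v, (∀ x ∈ C, ‖ι x v‖ ≤ 1) → ‖φ v‖ ≤ 1) :
    ∃ x ∈ C, ι x = φ :=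
  exists_mem_eq_of_mem_bipolar_weakBilin (LinearMap.id : Module.Dual 𝕜 V →ₗ[𝕜] V →ₗ[𝕜] 𝕜)
    Function.injective_id ι hC hne hcomp hι φ hφ

end Convexity

/-! ### Uniform boundedness through ℓ¹. -/

section UniformBoundedness

variable {𝕜 : Type*} [RCLike 𝕜] {X : Type*} [AddCommGroup X] [Module 𝕜 X]

/-- The functional `a ↦ ∑ a n * b n` on `ℓ¹` given by a bounded sequence `b`. -/
noncomputable def l1Functional (b : ℕ → 𝕜) (C : ℝ) (hb : ∀ n, ‖b n‖ ≤ C) :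
    lp (fun _ : ℕ => 𝕜) 1 →L[𝕜] 𝕜 :=
  have hs (a : lp (fun _ : ℕ => 𝕜) 1) : Summable fun n => ‖a n‖ := by
    simpa using (lp.memℓp a).summable (by simp)
  have hs' (a : lp (fun _ : ℕ => 𝕜) 1) : Summable fun n => ‖a n * b n‖ :=
    ((hs a).mul_right C).of_nonneg_of_le (fun _ => norm_nonneg _) fun n => by
      rw [norm_mul]; gcongr; exact hb n
  LinearMap.mkContinuous
    { toFun := fun a => ∑' n, a n * b n
      map_add' := fun a a' => by
        rw [← (hs' a).of_norm.tsum_add (hs' a').of_norm]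
        simp [add_mul]
      map_smul' := fun c a => by
        simp [mul_assoc, tsum_mul_left] } C fun a => by
    have h1 : ‖a‖ = ∑' n, ‖a n‖ := by
      simpa using lp.norm_eq_tsum_rpow (p := 1) (by simp) a
    calc ‖∑' n, a n * b n‖ ≤ ∑' n, ‖a n * b n‖ := norm_tsum_le_tsum_norm (hs' a)
      _ ≤ ∑' n, ‖a n‖ * C := (hs' a).tsum_le_tsum (fun n => by
          rw [norm_mul]; gcongr; exact hb n) ((hs a).mul_right C)
      _ = C * ‖a‖ := by rw [tsum_mul_right, h1, mul_comm]

theorem l1Functional_apply (b : ℕ → 𝕜) (C : ℝ) (hb : ∀ n, ‖b n‖ ≤ C)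
    (a : lp (fun _ : ℕ => 𝕜) 1) : l1Functional b C hb a = ∑' n, a n * b n := rfl

theorem summable_l1_mul (b : ℕ → 𝕜) (C : ℝ) (hb : ∀ n, ‖b n‖ ≤ C)
    (a : lp (fun _ : ℕ => 𝕜) 1) : Summable fun n => a n * b n := by
  have hs : Summable fun n => ‖a n‖ := by
    simpa using (lp.memℓp a).summable (by simp)
  refine Summable.of_norm ((hs.mul_right C).of_nonneg_of_le (fun n => norm_nonneg _) fun n => ?_)
  rw [norm_mul]
  exact mul_le_mul_of_nonneg_left (hb n) (norm_nonneg _)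

/-- A set on which every functional of a space `V` is bounded is absorbed by the prepolar of the
functionals in `V` bounded by one on `U`, if `V` is closed with respect to series which converge
absolutely and uniformly on `U`. -/
theorem exists_forall_norm_le_of_pointwise_bounded (V : Submodule 𝕜 (Module.Dual 𝕜 X)) {U : Set X}
    (habs : ∀ x : X, ∃ r : ℝ, ∀ v ∈ V, (∀ y ∈ U, ‖v y‖ ≤ 1) → ‖v x‖ ≤ r)
    (hlim : ∀ (f : ℕ → Module.Dual 𝕜 X) (c : ℕ → ℝ), Summable c → (∀ n, f n ∈ V) →
      (∀ n, ∀ y ∈ U, ‖f n y‖ ≤ c n) → ∀ g : Module.Dual 𝕜 X,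
      (∀ x, HasSum (fun n => f n x) (g x)) → g ∈ V)
    {B : Set X} (hB : ∀ v ∈ V, ∃ r : ℝ, ∀ x ∈ B, ‖v x‖ ≤ r) :
    ∃ r : ℝ, ∀ x ∈ B, ∀ v ∈ V, (∀ y ∈ U, ‖v y‖ ≤ 1) → ‖v x‖ ≤ r := by
  -- If there is no bound, choose `x n ∈ B` and `v n` in the polar of `U` with `‖v n (x n)‖ > n`.
  -- For `a` in ℓ¹ the series `∑ a n • v n` stays in `V`, so it is bounded on `B`. Thus the ℓ¹
  -- functionals attached to the points `x i` are pointwise bounded, and Banach-Steinhaus on ℓ¹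
  -- bounds their norms; testing on unit vectors gives a contradiction.
  by_contra! hcon
  choose x hxB v hvV hvU hv using fun n : ℕ => hcon n
  choose C hC using habs
  have hb (y : X) (n : ℕ) : ‖v n y‖ ≤ C y := hC y (v n) (hvV n) (hvU n)
  have key (a : lp (fun _ : ℕ => 𝕜) 1) :
      ∃ r, ∀ i : ℕ, ‖l1Functional (fun n => v n (x i)) (C (x i)) (hb _) a‖ ≤ r := by
    let g : Module.Dual 𝕜 X :=
      { toFun := fun y => ∑' n, a n * v n y
        map_add' := fun y z => by
          rw [← (summable_l1_mul _ _ (hb y) a).tsum_add (summable_l1_mul _ _ (hb z) a)]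
          simp [mul_add]
        map_smul' := fun c y => by
          simp [mul_left_comm, tsum_mul_left] }
    have hg : g ∈ V := by
      refine hlim (fun n => a n • v n) (fun n => ‖a n‖)
        (by simpa using (lp.memℓp a).summable (by simp)) (fun n => V.smul_mem _ (hvV n)) ?_ g ?_
      · intro n y hy
        rw [LinearMap.smul_apply, smul_eq_mul, norm_mul]
        exact mul_le_of_le_one_right (norm_nonneg _) (hvU n y hy)
      · intro y
        exact (summable_l1_mul _ _ (hb y) a).hasSum
    obtain ⟨r, hr⟩ := hB g hg
    exact ⟨r, fun i => hr (x i) (hxB i)⟩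
  obtain ⟨R, hR⟩ := banach_steinhaus key
  obtain ⟨n, hn⟩ := exists_nat_gt R
  have h1 : v n (x n) = l1Functional (fun k => v k (x n)) (C (x n)) (hb _) (lp.single 1 n 1) := by
    rw [l1Functional_apply, tsum_eq_single n]
    · simp
    · intro k hk
      simp [lp.single_apply, hk]
  have h2 := (l1Functional (fun k => v k (x n)) (C (x n)) (hb _)).le_of_opNorm_le (hR n)
    (lp.single 1 n 1)
  rw [← h1, lp.norm_single (by simp), norm_one, mul_one] at h2
  linarith [hv n]

end UniformBoundedness

/-! ### Strong duals and semi-reflexivity. -/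

section StrongDual

variable {𝕜 : Type*} [RCLike 𝕜] {X : Type*} [AddCommGroup X] [Module 𝕜 X]

theorem hasBasis_nhds_zero_strongDual [TopologicalSpace X] [ContinuousConstSMul 𝕜 X] :
    (𝓝 (0 : StrongDual 𝕜 X)).HasBasis (fun B : Set X => Bornology.IsVonNBounded 𝕜 B)
      fun B => {f | ∀ x ∈ B, ‖f x‖ ≤ 1} := by
  refine (ContinuousLinearMap.hasBasis_nhds_zero_of_basis
    (Metric.nhds_basis_closedBall (x := (0 : 𝕜)))).to_hasBasis ?_ ?_
  · rintro ⟨B, ε⟩ ⟨hB, hε : 0 < ε⟩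
    refine ⟨_, hB.image ((ε : 𝕜)⁻¹ • ContinuousLinearMap.id 𝕜 X), fun f hf x hx => ?_⟩
    have := hf _ ⟨x, hx, rfl⟩
    rw [_root_.smul_apply, ContinuousLinearMap.id_apply, map_smul, smul_eq_mul, norm_mul,
      norm_inv, RCLike.norm_ofReal, abs_of_pos hε, inv_mul_le_iff₀ hε, mul_one] at this
    simpa using this
  · intro B hB
    exact ⟨(B, 1), ⟨hB, one_pos⟩, fun f hf x hx => by simpa using hf x hx⟩

/-- A continuous linear functional on the strong dual of `X` is in the bipolar of some bounded
subset of `X`. -/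
theorem exists_isVonNBounded_mem_bipolar [TopologicalSpace X] [ContinuousConstSMul 𝕜 X]
    (φ : StrongDual 𝕜 (StrongDual 𝕜 X)) : ∃ B : Set X, Bornology.IsVonNBounded 𝕜 B ∧
      ∀ f : StrongDual 𝕜 X, (∀ x ∈ B, ‖f x‖ ≤ 1) → ‖φ f‖ ≤ 1 := by
  have h : φ ⁻¹' Metric.closedBall 0 1 ∈ 𝓝 (0 : StrongDual 𝕜 X) :=
    φ.continuous.continuousAt.preimage_mem_nhds
      (by simpa using Metric.closedBall_mem_nhds (0 : 𝕜) one_pos)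
  obtain ⟨B, hB, hφ⟩ := hasBasis_nhds_zero_strongDual.mem_iff.1 h
  exact ⟨B, hB, fun f hf => by simpa using hφ hf⟩

theorem _root_.Bornology.IsVonNBounded.exists_norm_le_of_continuous [TopologicalSpace X]
    {B : Set X} (hB : Bornology.IsVonNBounded 𝕜 B) (f : StrongDual 𝕜 X) :
    ∃ r : ℝ, ∀ x ∈ B, ‖f x‖ ≤ r := by
  obtain ⟨r, hr⟩ := (NormedSpace.isVonNBounded_iff' 𝕜).1 (hB.image f)
  exact ⟨r, fun x hx => hr _ ⟨x, hx, rfl⟩⟩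

/-- If each bounded set is contained in a compact absolutely convex set, then each continuous
linear functional on the strong dual is an evaluation. -/
theorem isSemiReflexive_of_exists_isCompact [t : TopologicalSpace X] [ContinuousSMul 𝕜 X]
    (h : ∀ B : Set X, Bornology.IsVonNBounded 𝕜 B → ∃ C, B ⊆ C ∧ AbsConvex 𝕜 C ∧ IsCompact C) :
    IsSemiReflexive 𝕜 t := by
  intro φ
  obtain ⟨B, hB, hφ⟩ := exists_isVonNBounded_mem_bipolar φ
  obtain ⟨C, hC, habs, hcomp⟩ := h (insert 0 B) (hB.insert 0)
  obtain ⟨x, -, hx⟩ := exists_mem_eq_of_mem_bipolar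
    (ι := (ContinuousLinearMap.coeLM 𝕜 : StrongDual 𝕜 X →ₗ[𝕜] X →ₗ[𝕜] 𝕜).flip) habs
    ⟨0, hC (Set.mem_insert _ _)⟩ hcomp (fun f => f.continuous.continuousOn) φ.toLinearMap
    fun f hf => hφ f fun x hx => hf x (hC (Set.mem_insert_of_mem _ hx))
  exact ⟨x, fun f => (LinearMap.congr_fun hx f).symm⟩

end StrongDual

/-! ### Compactness of polars. -/

section Alaoglu

variable {𝕜 : Type*} [RCLike 𝕜] {X Z : Type*} [AddCommGroup X] [Module 𝕜 X]
  [AddCommGroup Z] [Module 𝕜 Z]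

/-- A version of the Banach-Alaoglu theorem. -/
theorem isCompact_setOf_forall_norm_le [TopologicalSpace X] (L : X →ₗ[𝕜] Module.Dual 𝕜 Z)
    (hL : IsInducing fun x z => L x z) {U : Set Z}
    (habs : ∀ z, ∃ r : ℝ, ∀ φ : Module.Dual 𝕜 Z, (∀ y ∈ U, ‖φ y‖ ≤ 1) → ‖φ z‖ ≤ r)
    (hsurj : ∀ φ : Module.Dual 𝕜 Z, (∀ y ∈ U, ‖φ y‖ ≤ 1) → ∃ x, L x = φ) :
    IsCompact {x | ∀ y ∈ U, ‖L x y‖ ≤ 1} := by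
  choose r hr using habs
  rw [hL.isCompact_iff]
  -- Inside a product of balls, the polar is cut out by closed conditions: linearity and the bounds
  -- on `U`. Surjectivity of `L` onto the polar ensures that no limit point is missing.
  have himage : (fun x z => L x z) '' {x | ∀ y ∈ U, ‖L x y‖ ≤ 1} =
      Set.univ.pi (fun z => Metric.closedBall (0 : 𝕜) (r z)) ∩
        ((⋂ (y : Z) (z : Z), {g | g (y + z) = g y + g z}) ∩
          ((⋂ (c : 𝕜) (z : Z), {g | g (c • z) = c * g z}) ∩ ⋂ y ∈ U, {g | ‖g y‖ ≤ 1})) := by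
    ext g
    simp only [Set.mem_image, Set.mem_ofPred_eq, Set.mem_inter_iff, Set.mem_pi, Set.mem_univ,
      forall_const, Metric.mem_closedBall, dist_zero_right, Set.mem_iInter]
    constructor
    · rintro ⟨x, hx, rfl⟩
      exact ⟨fun z => hr z _ hx, by simp, by simp, hx⟩
    · rintro ⟨-, hadd, hsmul, hU⟩
      obtain ⟨x, hx⟩ := hsurj ⟨⟨g, hadd⟩, hsmul⟩ hU
      have hx' : ∀ z, L x z = g z := fun z => LinearMap.congr_fun hx z
      exact ⟨x, fun y hy => by rw [hx']; exact hU y hy, funext hx'⟩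
  rw [himage]
  refine (isCompact_univ_pi fun z => isCompact_closedBall _ _).inter_right ?_
  refine IsClosed.inter ?_ (IsClosed.inter ?_ ?_)
  · exact isClosed_iInter fun y => isClosed_iInter fun z => isClosed_eq (by fun_prop) (by fun_prop)
  · exact isClosed_iInter fun y => isClosed_iInter fun z => isClosed_eq (by fun_prop) (by fun_prop)
  · exact isClosed_iInter fun y => isClosed_iInter fun z => isClosed_le (by fun_prop) (by fun_prop)

end Alaoglu

/-! ### Induced locally convex topologies. -/

section Topologies

variable {𝕜 : Type*} [RCLike 𝕜] {X : Type*} [AddCommGroup X] [Module 𝕜 X]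
  {E : Type*} [AddCommGroup E] [Module 𝕜 E] [TopologicalSpace E] [IsTopologicalAddGroup E]
  [ContinuousSMul 𝕜 E] [LocallyConvexSpace 𝕜 E]

theorem isLCHausdorff_induced [T2Space E] (L : X →ₗ[𝕜] E) (hL : Function.Injective L) :
    IsLCHausdorff 𝕜 (TopologicalSpace.induced L inferInstance) where
  isTopologicalAddGroup := topologicalAddGroup_induced L
  continuousSMul := continuousSMul_induced L
  locallyConvexSpace := LocallyConvexSpace.induced L
  t2Space := by
    let _ : TopologicalSpace X := TopologicalSpace.induced L inferInstance
    exact (IsEmbedding.mk ⟨rfl⟩ hL).t2Space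

theorem IsLCHausdorff.inf_induced {τ : TopologicalSpace X} (h : IsLCHausdorff 𝕜 τ)
    (L : X →ₗ[𝕜] E) : IsLCHausdorff 𝕜 (τ ⊓ TopologicalSpace.induced L inferInstance) where
  isTopologicalAddGroup :=
    topologicalAddGroup_inf h.isTopologicalAddGroup (topologicalAddGroup_induced L)
  continuousSMul := @continuousSMul_inf _ _ _ _ _ _ h.continuousSMul (continuousSMul_induced L)
  locallyConvexSpace := LocallyConvexSpace.inf h.locallyConvexSpace (LocallyConvexSpace.induced L)
  t2Space := t2Space_antitone inf_le_left h.t2Space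

end Topologies

/-! ### Topologies that agree on a subset. -/

section Restriction

variable {X : Type*} {E : Type*} [TopologicalSpace E]

theorem induced_inf_induced_eq (τ : TopologicalSpace X) (L : X → E) {B : Set X}
    (hL : @ContinuousOn X E τ _ L B) :
    TopologicalSpace.induced ((↑) : B → X) (τ ⊓ TopologicalSpace.induced L inferInstance) =
      TopologicalSpace.induced ((↑) : B → X) τ := by
  rw [induced_inf, inf_eq_left, induced_compose, ← continuous_iff_le_induced]
  exact continuousOn_iff_continuous_domRestrict.1 hL

theorem isCompact_iff_of_induced_eq {τ σ : TopologicalSpace X} {C : Set X}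
    (h : TopologicalSpace.induced ((↑) : C → X) σ = TopologicalSpace.induced ((↑) : C → X) τ) :
    @IsCompact X σ C ↔ @IsCompact X τ C := by
  rw [@isCompact_iff_compactSpace X σ C, @isCompact_iff_compactSpace X τ C]
  change @CompactSpace C (TopologicalSpace.induced _ _) ↔
    @CompactSpace C (TopologicalSpace.induced _ _)
  rw [h]

theorem continuousOn_iff_of_induced_eq {τ σ : TopologicalSpace X}
    {C : Set X} (f : X → E)
    (h : TopologicalSpace.induced ((↑) : C → X) σ = TopologicalSpace.induced ((↑) : C → X) τ) :
    @ContinuousOn X E σ _ f C ↔ @ContinuousOn X E τ _ f C := by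
  rw [@continuousOn_iff_continuous_domRestrict X E σ, @continuousOn_iff_continuous_domRestrict X E τ]
  change @Continuous C E (TopologicalSpace.induced _ _) _ _ ↔
    @Continuous C E (TopologicalSpace.induced _ _) _ _
  rw [h]

end Restriction

/-! ### The topology γ̃, its dual and its bounded sets. -/

section MixedTopology

variable {𝕜 : Type v} [RCLike 𝕜] {X : Type*} [AddCommGroup X] [Module 𝕜 X]
  {τ τt : TopologicalSpace X}

theorem BBC.of_induced_eq {σ : TopologicalSpace X} (h : BBC 𝕜 τ τt)
    (hσ : ∀ B, IsBdd 𝕜 τ B →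
      TopologicalSpace.induced ((↑) : B → X) σ = TopologicalSpace.induced ((↑) : B → X) τt) :
    BBC 𝕜 τ σ := fun B hB => by
  obtain ⟨C, hBC, hC, hCb, hCc⟩ := h B hB
  exact ⟨C, hBC, hC, hCb, (isCompact_iff_of_induced_eq (hσ C hCb)).2 hCc⟩

theorem CNC.mono {σ : TopologicalSpace X} (h : CNC 𝕜 τ τt) (hσ : σ ≤ τt) : CNC 𝕜 τ σ := by
  obtain ⟨U₀, hU₀, hb⟩ := h
  exact ⟨U₀, fun U hU => ⟨(hU₀ U hU).1, (hU₀ U hU).2.mono hσ⟩, hb⟩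

theorem gammaTilde_le (h : IsLCHausdorff 𝕜 τt) : gammaTilde 𝕜 τ τt ≤ τt :=
  sInf_le ⟨h, fun _ _ => rfl⟩

/-- The join of τ̃ with the topology induced by `f` still agrees with τ̃ on bounded sets, so it is
coarser than γ̃. -/
theorem mem_boundedDual_iff (h : IsLCHausdorff 𝕜 τt) (f : Module.Dual 𝕜 X) :
    f ∈ boundedDual 𝕜 τ τt ↔ @Continuous X 𝕜 (gammaTilde 𝕜 τ τt) _ f := by
  have hγ := (isLeast_gammaTilde (𝕜 := 𝕜) τ τt h).1
  constructor
  · intro hf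
    rw [continuous_iff_le_induced]
    have hmem : τt ⊓ TopologicalSpace.induced f inferInstance ∈ mixedTopologies 𝕜 τ τt :=
      ⟨h.inf_induced f, fun B hB => induced_inf_induced_eq τt f (hf B hB)⟩
    exact (sInf_le hmem).trans inf_le_right
  · intro hf B hB
    exact (continuousOn_iff_of_induced_eq f (hγ.2 B hB)).1
      (@Continuous.continuousOn X 𝕜 (gammaTilde 𝕜 τ τt) _ f B hf)

theorem BBC.exists_norm_le (h : BBC 𝕜 τ τt) {f : Module.Dual 𝕜 X} (hf : f ∈ boundedDual 𝕜 τ τt)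
    {B : Set X} (hB : IsBdd 𝕜 τ B) : ∃ r : ℝ, ∀ x ∈ B, ‖f x‖ ≤ r := by
  obtain ⟨C, hBC, -, hC, hcomp⟩ := h B hB
  let _ := τt
  obtain ⟨r, hr⟩ := hcomp.exists_bound_of_continuousOn (hf C hC)
  exact ⟨r, fun x hx => hr x (hBC hx)⟩

theorem AbsConvex.exists_norm_le_of_absorbs {U B : Set X} (hU : AbsConvex 𝕜 U)
    (h : Absorbs 𝕜 U B) : ∃ r : ℝ, 0 < r ∧ ∀ (f : Module.Dual 𝕜 X) (c : ℝ),
      (∀ y ∈ U, ‖f y‖ ≤ c) → ∀ x ∈ B, ‖f x‖ ≤ r * c := by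
  obtain ⟨r, hr, h⟩ := hU.1.absorbs_iff_exists_inv_smul_mem.1 h
  refine ⟨r, hr, fun f c hf x hx => ?_⟩
  have := hf _ (h x hx)
  rwa [map_smul, smul_eq_mul, norm_mul, norm_inv, RCLike.norm_ofReal, abs_of_pos hr,
    inv_mul_le_iff₀ hr] at this

/-- Bipolar theorem: it makes the (CNC) neighbourhoods accessible to duality. -/
theorem eq_setOf_forall_norm_le (h : IsLCHausdorff 𝕜 τt) {U : Set X} (hU : AbsConvex 𝕜 U)
    (hcl : IsClosed[τt] U) (hne : U.Nonempty) :
    U = {x | ∀ f ∈ {f : Module.Dual 𝕜 X | @Continuous X 𝕜 τt _ f ∧ ∀ y ∈ U, ‖f y‖ ≤ 1},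
      ‖f x‖ ≤ 1} := by
  let _ := τt
  have := h.isTopologicalAddGroup
  have := h.continuousSMul
  have := h.locallyConvexSpace
  refine Set.Subset.antisymm (fun x hx f hf => hf.2 x hx) fun x hx => ?_
  by_contra hxU
  obtain ⟨f, hf, hfx⟩ := exists_strongDual_norm_le_one_lt hU hcl hne hxU
  exact absurd (hx f.toLinearMap ⟨f.continuous, hf⟩) (not_le.2 hfx)

/-- A set on which all functionals in the dual `V` of `(X, σ)` are bounded is absorbed by each
absolutely convex closed absorbing set, if `V` is closed with respect to series which converge
absolutely and uniformly on this set. -/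
theorem absorbs_of_pointwise_bounded {σ : TopologicalSpace X} (h : IsLCHausdorff 𝕜 σ)
    (V : Submodule 𝕜 (Module.Dual 𝕜 X)) (hV : ∀ f : Module.Dual 𝕜 X, @Continuous X 𝕜 σ _ f → f ∈ V)
    {U : Set X} (hU : AbsConvex 𝕜 U) (hcl : IsClosed[σ] U) (habs : Absorbent 𝕜 U)
    (hlim : ∀ (f : ℕ → Module.Dual 𝕜 X) (c : ℕ → ℝ), Summable c → (∀ n, f n ∈ V) →
      (∀ n, ∀ y ∈ U, ‖f n y‖ ≤ c n) → ∀ g : Module.Dual 𝕜 X,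
      (∀ x, HasSum (fun n => f n x) (g x)) → g ∈ V)
    {B : Set X} (hB : ∀ f ∈ V, ∃ r : ℝ, ∀ x ∈ B, ‖f x‖ ≤ r) : Absorbs 𝕜 U B := by
  have hne : U.Nonempty := ⟨0, habs.zero_mem⟩
  obtain ⟨r, hr⟩ := exists_forall_norm_le_of_pointwise_bounded V (U := U) (fun x => by
    obtain ⟨r, hr, h⟩ := AbsConvex.exists_norm_le_of_absorbs hU (habs x)
    exact ⟨r * 1, fun f _ hf => h f 1 hf x rfl⟩) hlim hB
  rw [eq_setOf_forall_norm_le h hU hcl hne, absorbs_setOf_forall_norm_le_iff]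
  exact ⟨r, fun x hx f hf => hr x hx f (hV f hf.1) hf.2⟩

/-- τ-bounded sets lie in γ̃-compact sets. Conversely, a γ̃-bounded set is bounded under every
functional in `boundedDual`, and the ℓ¹ argument makes this uniform on the polar of each (CNC)
neighbourhood. -/
theorem sameBounded_gammaTilde (hτ : IsLCHausdorff 𝕜 τ) (h : IsLCHausdorff 𝕜 τt)
    (hB : BBC 𝕜 τ τt) (hC : CNC 𝕜 τ τt) : SameBounded 𝕜 τ (gammaTilde 𝕜 τ τt) := by
  have hγ := (isLeast_gammaTilde (𝕜 := 𝕜) τ τt h).1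
  intro B
  constructor
  · intro hBb
    obtain ⟨C, hBC, -, -, hCc⟩ := hB.of_induced_eq hγ.2 B hBb
    let _ : TopologicalSpace X := gammaTilde 𝕜 τ τt
    have := hγ.1.isTopologicalAddGroup
    have := hγ.1.continuousSMul
    exact (IsCompact.isVonNBounded 𝕜 hCc).subset hBC
  · intro hBb
    obtain ⟨U₀, hU₀, hb⟩ := hC
    let _ := τ
    have := hτ.continuousSMul
    rw [IsBdd, hb.isVonNBounded_iff]
    intro U hU
    have hU0 : U ∈ 𝓝 (0 : X) := hb.mem_of_mem hU
    have hUabs := (hU₀ U hU).1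
    refine absorbs_of_pointwise_bounded h (boundedDual 𝕜 τ τt)
      (fun f hf B _ => @Continuous.continuousOn X 𝕜 τt _ f B hf) hUabs (hU₀ U hU).2
      (absorbent_nhds_zero hU0) ?_ ?_
    -- Since `U` absorbs `B'`, the terms are dominated by `r * c n` there, so the series converges
    -- uniformly on `B'` and its sum is continuous on `B'`.
    · intro f c hc hf hfc g hg B' hB'
      obtain ⟨r, hr, h⟩ := AbsConvex.exists_norm_le_of_absorbs hUabs (hB' hU0)
      have hg' : (g : X → 𝕜) = fun x => ∑' n, f n x := funext fun x => (hg x).tsum_eq.symm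
      rw [hg']
      exact @continuousOn_tsum ℕ X 𝕜 _ _ _ τt _ _ (fun n => hf n B' hB') (hc.mul_left r)
        fun n x hx => h (f n) (c n) (hfc n) x hx
    · intro f hf
      have hf' := (mem_boundedDual_iff h f).1 hf
      let _ : TopologicalSpace X := gammaTilde 𝕜 τ τt
      exact Bornology.IsVonNBounded.exists_norm_le_of_continuous hBb ⟨f, hf'⟩

end MixedTopology

/-! ### Complete strong duals and the strong bidual. -/

section Prebidual

variable {𝕜 : Type*} [RCLike 𝕜] {X : Type*} [AddCommGroup X] [Module 𝕜 X]

theorem BBC.montelSpace {τ : TopologicalSpace X} [σ : TopologicalSpace X] (h : BBC 𝕜 τ σ)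
    (hs : SameBounded 𝕜 τ σ) : MontelSpace 𝕜 X where
  heine_borel s hcl hb := by
    obtain ⟨C, hC, -, -, hCc⟩ := h s ((hs s).2 hb)
    exact hCc.of_isClosed_subset hcl hC

/-- The strong dual of `X` is complete if each linear functional which is continuous on all bounded
sets is continuous. -/
theorem completeSpace_strongDual [TopologicalSpace X] [ContinuousSMul 𝕜 X]
    (h : ∀ f : Module.Dual 𝕜 X, (∀ B : Set X, Bornology.IsVonNBounded 𝕜 B → ContinuousOn f B) →
      Continuous f) : CompleteSpace (StrongDual 𝕜 X) := by
  let 𝔖 : Set (Set X) := {B | Bornology.IsVonNBounded 𝕜 B}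
  have hemb : IsUniformInducing fun f : StrongDual 𝕜 X => UniformOnFun.ofFun 𝔖 (f : X → 𝕜) :=
    ContinuousLinearMap.isUniformEmbedding_toUniformOnFun.isUniformInducing
  rw [completeSpace_iff_isComplete_range hemb]
  apply IsClosed.isComplete
  have h1 (B : Set X) (hB : B ∈ 𝔖) :
      IsClosed {f : UniformOnFun X 𝕜 𝔖 | ContinuousOn (UniformOnFun.toFun 𝔖 f) B} := by
    refine isClosed_iff_forall_filter.2 fun f u _ hu huf => ?_
    rw [← Filter.tendsto_id', UniformOnFun.tendsto_iff_tendstoUniformlyOn] at huf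
    exact (huf B hB).continuousOn (Filter.Eventually.frequently (Filter.le_principal_iff.1 hu))
  have h2 : IsClosed {f : UniformOnFun X 𝕜 𝔖 |
      ∃ g : Module.Dual 𝕜 X, (g : X → 𝕜) = UniformOnFun.toFun 𝔖 f} :=
    (LinearMap.isClosed_range_coe X 𝕜 (RingHom.id 𝕜)).preimage
      (UniformOnFun.uniformContinuous_toFun
        Bornology.sUnion_isVonNBounded_eq_univ).continuous
  -- By hypothesis the dual is the set of functions that are linear and continuous on bounded sets.
  -- Both conditions survive uniform convergence on bounded sets.
  convert (isClosed_biInter h1).inter h2 using 1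
  · rfl
  refine Set.ext fun f => ?_
  simp only [Set.mem_range, Set.mem_inter_iff, Set.mem_iInter, Set.mem_ofPred_eq]
  constructor
  · rintro ⟨g, rfl⟩
    exact ⟨fun B _ => g.continuous.continuousOn, g.toLinearMap, rfl⟩
  · rintro ⟨hf, g, hg⟩
    exact ⟨⟨g, h g fun B hB => hg ▸ hf B hB⟩, hg⟩

/-- The evaluation map into the strong bidual. -/
noncomputable def evalBidual (𝕜 X : Type*) [RCLike 𝕜] [AddCommGroup X] [Module 𝕜 X]
    [TopologicalSpace X] [ContinuousSMul 𝕜 X] : X →ₗ[𝕜] StrongDual 𝕜 (StrongDual 𝕜 X) where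
  toFun x := ⟨{ toFun := fun f => f x, map_add' := fun _ _ => rfl, map_smul' := fun _ _ => rfl },
    continuous_eval_const x⟩
  map_add' x y := by ext f; exact map_add f x y
  map_smul' c x := by ext f; exact map_smul f c x

@[simp] theorem evalBidual_apply [TopologicalSpace X] [ContinuousSMul 𝕜 X] (x : X)
    (f : StrongDual 𝕜 X) : evalBidual 𝕜 X x f = f x := rfl

theorem IsLCHausdorff.separating [t : TopologicalSpace X] (h : IsLCHausdorff 𝕜 t) {x : X}
    (hx : ∀ f : StrongDual 𝕜 X, f x = 0) : x = 0 := by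
  have := h.isTopologicalAddGroup
  have := h.continuousSMul
  have := h.locallyConvexSpace
  have := h.t2Space
  by_contra hne
  obtain ⟨f, -, hf⟩ := exists_strongDual_norm_le_one_lt (𝕜 := 𝕜) (C := {0}) (x := x)
    ⟨by rintro a - _ ⟨y, rfl, rfl⟩; simp, convex_singleton 0⟩ isClosed_singleton
    (Set.singleton_nonempty 0) hne
  rw [hx, norm_zero] at hf
  exact absurd hf (by norm_num)

theorem evalBidual_bijective [t : TopologicalSpace X] [ContinuousSMul 𝕜 X]
    (h : IsLCHausdorff 𝕜 t) (hr : IsSemiReflexive 𝕜 t) :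
    Function.Bijective (evalBidual 𝕜 X) := by
  refine ⟨(injective_iff_map_eq_zero _).2 fun x hx => h.separating fun f => ?_, fun φ => ?_⟩
  · exact congrArg (fun φ : StrongDual 𝕜 (StrongDual 𝕜 X) => φ f) hx
  · obtain ⟨x, hx⟩ := hr φ
    exact ⟨x, by ext f; exact (hx f).symm⟩

theorem isHomeomorph_of_nhds_zero_eq {G H : Type*} [AddCommGroup G] [AddCommGroup H]
    [tG : TopologicalSpace G] [TopologicalSpace H] [IsTopologicalAddGroup G]
    [IsTopologicalAddGroup H] {F : Type*} [FunLike F G H]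
    [AddMonoidHomClass F G H] (e : F) (he : Function.Bijective e)
    (h : 𝓝 (0 : G) = Filter.comap e (𝓝 0)) : IsHomeomorph e := by
  have hind : IsInducing e := ⟨IsTopologicalAddGroup.ext inferInstance
    (topologicalAddGroup_induced e) (by rw [nhds_induced, map_zero, h])⟩
  exact isHomeomorph_iff_isEmbedding_surjective.2 ⟨⟨hind, he.1⟩, he.2⟩

/-- If `σ` is a locally convex Hausdorff topology with the same bounded sets as the bornological
topology `τ` and `τ` has a basis of absolutely convex `σ`-closed neighbourhoods of zero, then `τ` is
the topology of the strong bidual of `(X, σ)`. -/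
theorem isHomeomorph_evalBidual {τ : TopologicalSpace X} [σ : TopologicalSpace X]
    [ContinuousSMul 𝕜 X] (hτ : IsLCHausdorff 𝕜 τ) (hborn : IsBornological 𝕜 τ)
    (hσ : IsLCHausdorff 𝕜 σ) (hr : IsSemiReflexive 𝕜 σ) (hs : SameBounded 𝕜 τ σ)
    (hC : CNC 𝕜 τ σ) :
    @IsHomeomorph X (StrongDual 𝕜 (StrongDual 𝕜 X)) τ _ (evalBidual 𝕜 X) := by
  have := hτ.isTopologicalAddGroup
  refine isHomeomorph_of_nhds_zero_eq (tG := τ) (evalBidual 𝕜 X)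
    (evalBidual_bijective hσ hr) (le_antisymm ?_ ?_)
  · refine (hasBasis_nhds_zero_strongDual.comap _).ge_iff.2 fun M hM => ?_
    have hset : evalBidual 𝕜 X ⁻¹'
        {φ : StrongDual 𝕜 (StrongDual 𝕜 X) | ∀ f ∈ M, ‖φ f‖ ≤ 1} =
        {x : X | ∀ f ∈ (fun f : StrongDual 𝕜 X => f.toLinearMap) '' M, ‖f x‖ ≤ 1} := by
      ext x
      simp
    rw [hset]
    -- A strongly bounded `M` is absorbed by the polar of each bounded `B`. The estimate is
    -- symmetric, so the prepolar of `M` absorbs `B`, and bornologicity makes it a τ-neighbourhood.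
    refine hborn _ (absConvex_setOf_forall_norm_le _) fun B hB => ?_
    rw [absorbs_setOf_forall_norm_le_iff]
    have hB' := hasBasis_nhds_zero_strongDual.mem_of_mem ((hs B).1 hB)
    have hset' : {f : StrongDual 𝕜 X | ∀ x ∈ B, ‖f x‖ ≤ 1} =
        {f | ∀ φ ∈ (fun x => (evalBidual 𝕜 X x).toLinearMap) '' B, ‖φ f‖ ≤ 1} := by
      ext f
      simp
    have habs := hM hB'
    rw [hset', absorbs_setOf_forall_norm_le_iff] at habs
    obtain ⟨r, hr⟩ := habs
    refine ⟨r, ?_⟩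
    rintro x hx _ ⟨f, hf, rfl⟩
    exact hr f hf _ ⟨x, hx, rfl⟩
  · obtain ⟨U₀, hU₀, hb⟩ := hC
    refine hb.ge_iff.2 fun U hU => ?_
    have hU0 := hb.mem_of_mem hU
    have hne : U.Nonempty := ⟨0, @mem_of_mem_nhds X τ 0 U hU0⟩
    -- The polar of `U` is strongly bounded because `U` absorbs bounded sets; its prepolar is `U`
    -- again, as `U` is σ-closed.
    let M : Set (StrongDual 𝕜 X) := {f | ∀ y ∈ U, ‖f y‖ ≤ 1}
    have hM : Bornology.IsVonNBounded 𝕜 M := by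
      rw [hasBasis_nhds_zero_strongDual.isVonNBounded_iff]
      intro B hB
      obtain ⟨r, hr, h⟩ := AbsConvex.exists_norm_le_of_absorbs (hU₀ U hU).1 ((hs B).2 hB hU0)
      have hset' : {f : StrongDual 𝕜 X | ∀ x ∈ B, ‖f x‖ ≤ 1} =
          {f | ∀ φ ∈ (fun x => (evalBidual 𝕜 X x).toLinearMap) '' B, ‖φ f‖ ≤ 1} := by
        ext f
        simp
      rw [hset', absorbs_setOf_forall_norm_le_iff]
      refine ⟨r * 1, ?_⟩
      rintro f hf _ ⟨x, hx, rfl⟩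
      exact h f.toLinearMap 1 hf x hx
    refine Filter.mem_of_superset
      (Filter.preimage_mem_comap (hasBasis_nhds_zero_strongDual.mem_of_mem hM)) fun x hx => ?_
    rw [id, eq_setOf_forall_norm_le hσ (hU₀ U hU).1 (hU₀ U hU).2 hne]
    intro f hf
    exact hx ⟨f, hf.1⟩ hf.2

end Prebidual

/-! ### Semi-Montel spaces and barrelled strong duals. -/

section Barrelled

variable {𝕜 : Type*} [RCLike 𝕜] {Y : Type*} [AddCommGroup Y] [Module 𝕜 Y]

theorem isSemiReflexive_of_montelSpace [t : TopologicalSpace Y] (h : IsLCHausdorff 𝕜 t)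
    [MontelSpace 𝕜 Y] : IsSemiReflexive 𝕜 t := by
  have := h.isTopologicalAddGroup
  have := h.continuousSMul
  have := h.locallyConvexSpace
  refine isSemiReflexive_of_exists_isCompact fun B hB => ?_
  refine ⟨closedAbsConvexHull 𝕜 B, subset_closedAbsConvexHull, absConvex_convexClosedHull,
    MontelSpace.isCompact_of_isClosed_of_isVonNBounded 𝕜 isClosed_closedAbsConvexHull ?_⟩
  rw [(nhds_hasBasis_absConvex_closed 𝕜 Y).isVonNBounded_iff]
  rintro U ⟨hU0, hUcl, hU⟩
  obtain ⟨r, hr, h⟩ := hU.1.absorbs_iff_exists_inv_smul_mem.1 (hB hU0)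
  refine hU.1.absorbs_iff_exists_inv_smul_mem.2 ⟨r, hr, fun x hx => ?_⟩
  -- The preimage of `U` under this scaling is closed, absolutely convex and contains `B`, so it
  -- contains the hull.
  let L : Y →ₗ[𝕜] Y := (r : 𝕜)⁻¹ • LinearMap.id
  refine closedAbsConvexHull_min (t := L ⁻¹' U) (fun y hy => h y hy) ⟨?_, hU.2.linear_preimage L⟩
    (hUcl.preimage (continuous_const_smul _)) hx
  rintro a ha _ ⟨y, hy, rfl⟩
  simpa [L, smul_comm a] using hU.1.smul_mem ha hy

/-- The strong dual of a semi-reflexive space is barrelled. -/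
theorem barrelledSpace_strongDual [t : TopologicalSpace Y] (h : IsLCHausdorff 𝕜 t)
    (hr : IsSemiReflexive 𝕜 t) : BarrelledSpace 𝕜 (StrongDual 𝕜 Y) where
  continuous_of_lowerSemicontinuous p hp := by
    have := h.isTopologicalAddGroup
    have := h.continuousSMul
    have := h.locallyConvexSpace
    -- The prepolar of the unit ball of `p`. Its polar will be shown to lie in that ball, so it
    -- remains to see that `A` is bounded; this is the ℓ¹ argument with the whole dual as `V`.
    let A : Set Y := {y | ∀ f : StrongDual 𝕜 Y, p f ≤ 1 → ‖f y‖ ≤ 1}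
    have hA : Bornology.IsVonNBounded 𝕜 A := by
      rw [(nhds_hasBasis_absConvex_closed 𝕜 Y).isVonNBounded_iff]
      rintro U ⟨hU0, hUcl, hU⟩
      refine absorbs_of_pointwise_bounded h
        (LinearMap.range (ContinuousLinearMap.coeLM 𝕜 : StrongDual 𝕜 Y →ₗ[𝕜] Y →ₗ[𝕜] 𝕜))
        (fun f hf => ⟨⟨f, hf⟩, rfl⟩) hU hUcl (absorbent_nhds_zero hU0) ?_ ?_
      · intro f c hc hf hfc g hg
        -- The sum is bounded by `∑ c n` on the neighbourhood `U`, hence continuous.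
        have hgU : ∃ V ∈ 𝓝 (0 : Y), Bornology.IsVonNBounded 𝕜 (g '' V) := by
          refine ⟨U, hU0, (NormedSpace.isVonNBounded_iff' 𝕜).2 ⟨∑' n, c n, ?_⟩⟩
          rintro _ ⟨y, hy, rfl⟩
          rw [← (hg y).tsum_eq]
          exact tsum_of_norm_bounded hc.hasSum fun n => hfc n y hy
        exact ⟨g.clmOfExistsBoundedImage hgU, rfl⟩
      · rintro _ ⟨f, rfl⟩
        refine ⟨p f + 1, fun y hy => ?_⟩
        have hpos : 0 < p f + 1 := by positivity
        have := hy (((p f + 1 : ℝ) : 𝕜)⁻¹ • f) (by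
          rw [map_smul_eq_mul, norm_inv, RCLike.norm_ofReal, abs_of_pos hpos,
            inv_mul_le_iff₀ hpos]
          linarith)
        rw [_root_.smul_apply, smul_eq_mul, norm_mul, norm_inv, RCLike.norm_ofReal,
          abs_of_pos hpos, inv_mul_le_iff₀ hpos, mul_one] at this
        exact this
    refine Seminorm.continuous' (r := 1)
      (Filter.mem_of_superset (hasBasis_nhds_zero_strongDual.mem_of_mem hA) fun f hf => ?_)
    -- A point outside the closed unit ball of `p` is separated by a functional, which
    -- semi-reflexivity realises as evaluation at a point of `A`.
    by_contra hfp
    have hclosed : IsClosed (p.closedBall 0 1) := by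
      rw [p.closedBall_zero_eq]
      exact hp.isClosed_preimage 1
    obtain ⟨φ, hφ, hφf⟩ := exists_strongDual_norm_le_one_lt (C := p.closedBall 0 1)
      ⟨p.balanced_closedBall_zero 1, (convex_RCLike_iff_convex_real (K := 𝕜)).2
        (p.convex_closedBall 0 1)⟩ hclosed
      ⟨0, by simp [p.mem_closedBall_zero]⟩ hfp
    obtain ⟨y, hy⟩ := hr φ
    rw [hy] at hφf
    exact absurd (hf y fun g hg => hy g ▸ hφ g (p.mem_closedBall_zero.2 hg)) (not_le.2 hφf)

end Barrelled

/-! ### Weak topologies satisfying (BBC) and (CNC). -/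

section WeakTopologies

variable {𝕜 : Type*} [RCLike 𝕜] {X : Type*} [AddCommGroup X] [Module 𝕜 X]

/-- The strong dual of a barrelled space satisfies (BBC) and (CNC) for the weak* topology. -/
theorem exists_BBC_CNC_of_barrelledSpace {Y : Type*} [AddCommGroup Y] [Module 𝕜 Y]
    [uY : UniformSpace Y] [IsUniformAddGroup Y] (hY : IsLCHausdorff 𝕜 uY.toTopologicalSpace)
    [BarrelledSpace 𝕜 Y] {τ : TopologicalSpace X} (T : X ≃ₗ[𝕜] StrongDual 𝕜 Y)
    (hT : @IsHomeomorph X (StrongDual 𝕜 Y) τ _ T) :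
    ∃ τt : TopologicalSpace X, IsLCHausdorff 𝕜 τt ∧ BBC 𝕜 τ τt ∧ CNC 𝕜 τ τt ∧
      ∀ y : Y, @Continuous X 𝕜 τt _ fun x => T x y := by
  have := hY.isTopologicalAddGroup
  have := hY.continuousSMul
  have := hY.locallyConvexSpace
  let L : X →ₗ[𝕜] Y → 𝕜 :=
    { toFun := fun x y => T x y
      map_add' := fun a b => by ext y; simp
      map_smul' := fun c a => by ext y; simp }
  let D : X →ₗ[𝕜] Module.Dual 𝕜 Y :=
    { toFun := fun x => (T x).toLinearMap
      map_add' := fun a b => by ext y; simp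
      map_smul' := fun c a => by ext y; simp }
  have hL : Function.Injective L := fun a b hab =>
    T.injective (by ext y; exact congrFun hab y)
  have hcont (y : Y) : @Continuous X 𝕜 (TopologicalSpace.induced L inferInstance) _
      fun x => T x y :=
    @Continuous.comp X (Y → 𝕜) 𝕜 (_) _ _ L (fun g => g y) (continuous_apply y)
      continuous_induced_dom
  have hset (U : Set Y) : {x : X | ∀ y ∈ U, ‖T x y‖ ≤ 1} =
      {x | ∀ f ∈ (fun y => (LinearMap.flip D y : Module.Dual 𝕜 X)) '' U, ‖f x‖ ≤ 1} := by
    ext x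
    simp [D]
  have hbasis : (@nhds X τ 0).HasBasis (fun B : Set Y => Bornology.IsVonNBounded 𝕜 B)
      fun B => {x | ∀ y ∈ B, ‖T x y‖ ≤ 1} := by
    have h0 : @nhds X τ 0 = Filter.comap T (𝓝 0) := by
      rw [← map_zero T]
      exact hT.isInducing.nhds_eq_comap 0
    rw [h0]
    exact hasBasis_nhds_zero_strongDual.comap T
  refine ⟨TopologicalSpace.induced L inferInstance, isLCHausdorff_induced L hL, fun B hB => ?_,
    ⟨{W | ∃ B : Set Y, Bornology.IsVonNBounded 𝕜 B ∧ W = {x | ∀ y ∈ B, ‖T x y‖ ≤ 1}}, ?_, ?_⟩,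
    hcont⟩
  · have hB' : Bornology.IsVonNBounded 𝕜 (T '' B) := by
      let _ := τ
      exact hB.image (⟨T.toLinearMap, hT.continuous⟩ : X →L[𝕜] StrongDual 𝕜 Y)
    -- By barrelledness the pointwise bounded family `T '' B` is equicontinuous, hence bounded by
    -- one on some neighbourhood `U`. The polar of `U` is the required compact set.
    have hequi : UniformEquicontinuous (DFunLike.coe ∘ fun b : B => T b) := by
      refine PolynormableSpace.banach_steinhaus (𝕜₁ := 𝕜) (𝕜₂ := 𝕜) fun y => ?_
      refine (hB'.image (evalBidual 𝕜 Y y)).subset ?_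
      rintro _ ⟨b, rfl⟩
      exact ⟨_, ⟨b, b.2, rfl⟩, rfl⟩
    obtain ⟨U, ⟨hU0, hU⟩, hUB⟩ := (nhds_hasBasis_absConvex 𝕜 Y).mem_iff.1
      (hequi.equicontinuous 0 _ (Metric.dist_mem_uniformity one_pos))
    refine ⟨{x | ∀ y ∈ U, ‖T x y‖ ≤ 1}, fun x hx y hy => ?_, ?_, ?_, ?_⟩
    · have : dist (T x 0) (T x y) < 1 := hUB hy ⟨x, hx⟩
      simpa using this.le
    · rw [hset]
      exact absConvex_setOf_forall_norm_le _
    · let _ := τ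
      rw [IsBdd, hbasis.isVonNBounded_iff]
      intro A hA
      obtain ⟨r, hr, h⟩ := AbsConvex.exists_norm_le_of_absorbs hU (hA hU0)
      rw [hset, absorbs_setOf_forall_norm_le_iff]
      refine ⟨r * 1, ?_⟩
      rintro x hx _ ⟨y, hy, rfl⟩
      exact h (D x) 1 hx y hy
    · let _ : TopologicalSpace X := TopologicalSpace.induced L inferInstance
      refine isCompact_setOf_forall_norm_le D ⟨rfl⟩ (U := U) (fun z => ?_) fun φ hφ => ?_
      · obtain ⟨r, hr, h⟩ := AbsConvex.exists_norm_le_of_absorbs hU (absorbent_nhds_zero hU0 z)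
        exact ⟨r * 1, fun φ hφ => h φ 1 hφ z rfl⟩
      · have hbd : ∃ V ∈ 𝓝 (0 : Y), Bornology.IsVonNBounded 𝕜 (φ '' V) := by
          refine ⟨U, hU0, (NormedSpace.isVonNBounded_iff' 𝕜).2 ⟨1, ?_⟩⟩
          rintro _ ⟨y, hy, rfl⟩
          exact hφ y hy
        refine ⟨T.symm (φ.clmOfExistsBoundedImage hbd), ?_⟩
        ext y
        simp [D]
  · rintro _ ⟨B, -, rfl⟩
    refine ⟨?_, ?_⟩
    · rw [hset]
      exact absConvex_setOf_forall_norm_le _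
    · let _ : TopologicalSpace X := TopologicalSpace.induced L inferInstance
      have : {x : X | ∀ y ∈ B, ‖T x y‖ ≤ 1} = ⋂ y ∈ B, {x | ‖T x y‖ ≤ 1} := by
        ext x
        simp
      rw [this]
      exact isClosed_biInter fun y _ => isClosed_le (hcont y).norm continuous_const
  · refine hbasis.to_hasBasis (fun B hB => ⟨_, ⟨B, hB, rfl⟩, subset_rfl⟩) ?_
    rintro _ ⟨B, hB, rfl⟩
    exact ⟨B, hB, subset_rfl⟩

/-- A semi-reflexive topology `σ` with the same bounded sets as `τ` may be replaced by its weak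
topology to obtain (BBC). -/
theorem exists_BBC_CNC_of_isSemiReflexive {τ : TopologicalSpace X} [σ : TopologicalSpace X]
    (hσ : IsLCHausdorff 𝕜 σ) (hr : IsSemiReflexive 𝕜 σ) (hs : SameBounded 𝕜 τ σ)
    (hC : CNC 𝕜 τ σ) :
    ∃ τt : TopologicalSpace X, IsLCHausdorff 𝕜 τt ∧ BBC 𝕜 τ τt ∧ CNC 𝕜 τ τt ∧
      ∀ f : Module.Dual 𝕜 X, @Continuous X 𝕜 σ _ f → @Continuous X 𝕜 τt _ f := by
  have := hσ.continuousSMul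
  let D : X →ₗ[𝕜] Module.Dual 𝕜 (StrongDual 𝕜 X) :=
    (ContinuousLinearMap.coeLM 𝕜 : StrongDual 𝕜 X →ₗ[𝕜] X →ₗ[𝕜] 𝕜).flip
  let L : X →ₗ[𝕜] StrongDual 𝕜 X → 𝕜 :=
    { toFun := fun x f => f x
      map_add' := fun a b => by ext f; simp
      map_smul' := fun c a => by ext f; simp }
  have hL : Function.Injective L := (injective_iff_map_eq_zero _).2 fun x hx =>
    hσ.separating fun f => congrFun hx f
  have hcont (f : Module.Dual 𝕜 X) (hf : @Continuous X 𝕜 σ _ f) :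
      @Continuous X 𝕜 (TopologicalSpace.induced L inferInstance) _ f :=
    @Continuous.comp X (StrongDual 𝕜 X → 𝕜) 𝕜 (_) _ _ L (fun g => g ⟨f, hf⟩)
      (continuous_apply (A := fun _ : StrongDual 𝕜 X => 𝕜) ⟨f, hf⟩) continuous_induced_dom
  obtain ⟨U₀, hU₀, hb⟩ := hC
  have hne (U : Set X) (hU : U ∈ U₀) : U.Nonempty :=
    ⟨0, @mem_of_mem_nhds X τ 0 U (hb.mem_of_mem hU)⟩
  refine ⟨TopologicalSpace.induced L inferInstance, isLCHausdorff_induced L hL, fun B hB => ?_,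
    ⟨U₀, fun U hU => ⟨(hU₀ U hU).1, ?_⟩, hb⟩, hcont⟩
  · have hBσ := (hs B).1 hB
    -- The compact set will be the bipolar of `B`. Functionals bounded on the neighbourhood `P` are
    -- continuous, so they are evaluations by semi-reflexivity and Alaoglu applies. It is τ-bounded
    -- since each (CNC) neighbourhood is a prepolar of σ-continuous functionals.
    let P : Set (StrongDual 𝕜 X) := {f | ∀ x ∈ B, ‖f x‖ ≤ 1}
    have hP : P ∈ 𝓝 (0 : StrongDual 𝕜 X) := hasBasis_nhds_zero_strongDual.mem_of_mem hBσ
    have hbdd (U : Set X) (hU : U ∈ U₀) : ∃ r : ℝ, ∀ x ∈ {x | ∀ f ∈ P, ‖f x‖ ≤ 1},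
        ∀ f : Module.Dual 𝕜 X, @Continuous X 𝕜 σ _ f → (∀ y ∈ U, ‖f y‖ ≤ 1) → ‖f x‖ ≤ r := by
      obtain ⟨r, hr0, h⟩ :=
        AbsConvex.exists_norm_le_of_absorbs (hU₀ U hU).1 (hB (hb.mem_of_mem hU))
      refine ⟨r, fun x hx f hf hfU => ?_⟩
      have := hx ((r : 𝕜)⁻¹ • (⟨f, hf⟩ : StrongDual 𝕜 X)) fun y hy => by
        rw [_root_.smul_apply, smul_eq_mul, norm_mul, norm_inv, RCLike.norm_ofReal,
          abs_of_pos hr0, inv_mul_le_iff₀ hr0]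
        exact h f 1 hfU y hy
      rwa [_root_.smul_apply, smul_eq_mul, norm_mul, norm_inv, RCLike.norm_ofReal,
        abs_of_pos hr0, inv_mul_le_iff₀ hr0, mul_one] at this
    have habs (f : StrongDual 𝕜 X) : ∃ r : ℝ, ∀ φ : Module.Dual 𝕜 (StrongDual 𝕜 X),
        (∀ g ∈ P, ‖φ g‖ ≤ 1) → ‖φ f‖ ≤ r := by
      obtain ⟨r, hr0, hr⟩ := (absorbent_nhds_zero (𝕜 := 𝕜) hP f).exists_pos
      refine ⟨r, fun φ hφ => ?_⟩
      have hr' : (r : 𝕜) ≠ 0 := by exact_mod_cast hr0.ne'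
      have := hφ _ ((Set.mem_smul_set_iff_inv_smul_mem₀ hr' _ _).1
        (hr (r : 𝕜) (by simp [abs_of_pos hr0]) rfl))
      rwa [map_smul, smul_eq_mul, norm_mul, norm_inv, RCLike.norm_ofReal,
        abs_of_pos hr0, inv_mul_le_iff₀ hr0, mul_one] at this
    have hsurj (φ : Module.Dual 𝕜 (StrongDual 𝕜 X)) (hφ : ∀ f ∈ P, ‖φ f‖ ≤ 1) :
        ∃ x, D x = φ := by
      have hbd : ∃ V ∈ 𝓝 (0 : StrongDual 𝕜 X), Bornology.IsVonNBounded 𝕜 (φ '' V) := by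
        refine ⟨P, hP, (NormedSpace.isVonNBounded_iff' 𝕜).2 ⟨1, ?_⟩⟩
        rintro _ ⟨y, hy, rfl⟩
        exact hφ y hy
      obtain ⟨x, hx⟩ := hr (φ.clmOfExistsBoundedImage hbd)
      exact ⟨x, LinearMap.ext fun f => (hx f).symm⟩
    refine ⟨{x | ∀ f ∈ P, ‖f x‖ ≤ 1}, fun x hx f hf => hf x hx, ?_, ?_, ?_⟩
    · convert absConvex_setOf_forall_norm_le (𝕜 := 𝕜)
        ((fun f : StrongDual 𝕜 X => f.toLinearMap) '' P) using 1
      ext x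
      simp
    · suffices h : ∀ U ∈ U₀, Absorbs 𝕜 U {x | ∀ f ∈ P, ‖f x‖ ≤ 1} by
        let _ := τ
        exact hb.isVonNBounded_iff.2 h
      intro U hU
      obtain ⟨r, hr⟩ := hbdd U hU
      rw [eq_setOf_forall_norm_le hσ (hU₀ U hU).1 (hU₀ U hU).2 (hne U hU),
        absorbs_setOf_forall_norm_le_iff]
      exact ⟨r, fun x hx f hf => hr x hx f hf.1 hf.2⟩
    · exact @isCompact_setOf_forall_norm_le 𝕜 _ X _ _ _ _ _
        (TopologicalSpace.induced L inferInstance) D (@IsInducing.mk _ _ (_) _ _ rfl) P habs hsurj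
  · rw [eq_setOf_forall_norm_le hσ (hU₀ U hU).1 (hU₀ U hU).2 (hne U hU)]
    let M : Set (Module.Dual 𝕜 X) := {f | @Continuous X 𝕜 σ _ f ∧ ∀ y ∈ U, ‖f y‖ ≤ 1}
    have hM (f : Module.Dual 𝕜 X) (hf : f ∈ M) :
        @Continuous X 𝕜 (TopologicalSpace.induced L inferInstance) _ f := hcont f hf.1
    change @IsClosed X (TopologicalSpace.induced L inferInstance) {x | ∀ f ∈ M, ‖f x‖ ≤ 1}
    clear_value M
    have : {x : X | ∀ f ∈ M, ‖f x‖ ≤ 1} = ⋂ f ∈ M, {x | ‖f x‖ ≤ 1} := by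
      ext x
      simp
    rw [this]
    let _ : TopologicalSpace X := TopologicalSpace.induced L inferInstance
    exact isClosed_biInter fun f hf => isClosed_le (hM f hf).norm continuous_const

end WeakTopologies

/-! ### Transfer to an arbitrary universe. -/

section ULift

variable {𝕜 : Type*} [RCLike 𝕜] {X : Type u} [AddCommGroup X] [Module 𝕜 X]
  [t : TopologicalSpace X]

theorem IsLCHausdorff.ulift (h : IsLCHausdorff 𝕜 t) :
    IsLCHausdorff 𝕜 (inferInstance : TopologicalSpace (ULift.{w} X)) := by
  have := h.isTopologicalAddGroup
  have := h.continuousSMul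
  have := h.locallyConvexSpace
  have := h.t2Space
  exact isLCHausdorff_induced (ULift.moduleEquiv : ULift.{w} X ≃ₗ[𝕜] X).toLinearMap
    ULift.down_injective

theorem montelSpace_ulift [MontelSpace 𝕜 X] : MontelSpace 𝕜 (ULift.{w} X) where
  heine_borel s hcl hb := by
    let e : ULift.{w} X ≃L[𝕜] X := ContinuousLinearEquiv.ulift
    have hc := MontelSpace.isCompact_of_isClosed_of_isVonNBounded 𝕜
      (e.toHomeomorph.isClosedMap s hcl) (hb.image (e : ULift.{w} X →L[𝕜] X))
    exact (e.toHomeomorph.isCompact_image).1 hc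

theorem completeSpace_strongDual_ulift [CompleteSpace (StrongDual 𝕜 X)] :
    CompleteSpace (StrongDual 𝕜 (ULift.{w} X)) := by
  let e : StrongDual 𝕜 (ULift.{w} X) ≃L[𝕜] StrongDual 𝕜 X :=
    ContinuousLinearEquiv.ulift.arrowCongr (ContinuousLinearEquiv.refl 𝕜 𝕜)
  exact (completeSpace_congr (e := e.toEquiv) e.isUniformEmbedding).2 inferInstance

end ULift

theorem exists_isHomeomorph_bidual_ulift {𝕜 : Type*} [RCLike 𝕜] {X : Type u}
    [AddCommGroup X] [Module 𝕜 X] {τ : TopologicalSpace X} [TopologicalSpace X]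
    [ContinuousSMul 𝕜 X]
    (h : @IsHomeomorph X (StrongDual 𝕜 (StrongDual 𝕜 X)) τ _ (evalBidual 𝕜 X)) :
    ∃ φ : X ≃ₗ[𝕜] StrongDual 𝕜 (StrongDual 𝕜 (ULift.{w} X)),
      @IsHomeomorph X (StrongDual 𝕜 (StrongDual 𝕜 (ULift.{w} X))) τ _ φ ∧
      ∀ x y, φ x y = y (ULift.up x) := by
  let e : StrongDual 𝕜 (ULift.{w} X) ≃L[𝕜] StrongDual 𝕜 X :=
    ContinuousLinearEquiv.ulift.arrowCongr (ContinuousLinearEquiv.refl 𝕜 𝕜)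
  let e' : StrongDual 𝕜 (StrongDual 𝕜 X) ≃L[𝕜] StrongDual 𝕜 (StrongDual 𝕜 (ULift.{w} X)) :=
    e.symm.arrowCongr (ContinuousLinearEquiv.refl 𝕜 𝕜)
  exact ⟨(LinearEquiv.ofBijective _ (@IsHomeomorph.bijective X _ τ _ _ h)).trans e'.toLinearEquiv,
    @IsHomeomorph.comp X _ _ τ _ _ (evalBidual 𝕜 X) e' e'.toHomeomorph.isHomeomorph h, fun _ _ => rfl⟩

/-! ### Function spaces and their point evaluations. -/

section FunctionSpaces

variable {𝕜 : Type v} [RCLike 𝕜] {Ω : Type u} {F : Submodule 𝕜 (Ω → 𝕜)}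
  {τ τt : TopologicalSpace F}

theorem le_pointwiseTopology_iff :
    τt ≤ pointwiseTopology F ↔ ∀ x, @Continuous F 𝕜 τt _ (pointEval F x) := by
  rw [pointwiseTopology, ← continuous_iff_le_induced]
  exact continuous_pi_iff

theorem HasSemiMontelPrebidualWithEvaluations.of_BBC_CNC (hτ : IsLCHausdorff 𝕜 τ)
    (hborn : IsBornological 𝕜 τ) (h : IsLCHausdorff 𝕜 τt) (hp : τt ≤ pointwiseTopology F)
    (hB : BBC 𝕜 τ τt) (hC : CNC 𝕜 τ τt) (hs : SameBounded 𝕜 τ (gammaTilde 𝕜 τ τt)) :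
    HasSemiMontelPrebidualWithEvaluations.{u, v, w} F τ := by
  have hγ := (isLeast_gammaTilde (𝕜 := 𝕜) τ τt h).1
  let _ : TopologicalSpace F := gammaTilde 𝕜 τ τt
  have := (hB.of_induced_eq hγ.2).montelSpace hs
  have := hγ.1.continuousSMul
  have : CompleteSpace (StrongDual 𝕜 F) := completeSpace_strongDual fun f hf =>
    (mem_boundedDual_iff h f).1 fun B hB =>
      (continuousOn_iff_of_induced_eq f (hγ.2 B hB)).1 (hf B ((hs B).1 hB))
  obtain ⟨φ, hφ, hφ'⟩ := exists_isHomeomorph_bidual_ulift.{max u v, w} (𝕜 := 𝕜) (X := F)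
    (isHomeomorph_evalBidual hτ hborn hγ.1 (isSemiReflexive_of_montelSpace hγ.1) hs
      (hC.mono (gammaTilde_le h)))
  refine ⟨ULift.{w} F, inferInstance, inferInstance, inferInstance, hγ.1.ulift,
    montelSpace_ulift, completeSpace_strongDual_ulift, φ, hφ, fun x => ?_⟩
  have hx := le_pointwiseTopology_iff.1 ((gammaTilde_le (𝕜 := 𝕜) (τ := τ) h).trans hp) x
  refine ⟨(⟨pointEval F x, hx⟩ : StrongDual 𝕜 F).comp
    (ContinuousLinearEquiv.ulift : ULift.{w} F ≃L[𝕜] F).toContinuousLinearMap,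
    fun f => by rw [hφ']; rfl, fun y hy => ?_⟩
  ext ⟨f⟩
  exact ((hy f).trans (hφ' f y)).symm

theorem AdmitsStrongCompleteBarrelledLinearisation.of_prebidual
    (h : HasSemiMontelPrebidualWithEvaluations.{u, v, w} F τ) :
    AdmitsStrongCompleteBarrelledLinearisation.{u, v, w} F τ := by
  obtain ⟨Y, _, _, tY, hY, hM, hc, φ, hφ, hδ⟩ := h
  have := hY.isTopologicalAddGroup
  have := hY.continuousSMul
  choose δ hδ _ using hδ
  exact ⟨StrongDual 𝕜 Y, inferInstance, inferInstance, inferInstance, inferInstance,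
    ⟨inferInstance, inferInstance, inferInstance, inferInstance⟩, hc,
    barrelledSpace_strongDual hY (isSemiReflexive_of_montelSpace hY), δ, φ, hφ,
    fun f => funext fun x => (hδ x f).symm⟩

end FunctionSpaces

end LCLin

theorem mainTheorem2 {𝕜 : Type v} [RCLike 𝕜] {Ω : Type u} [Nonempty Ω]
    (F : Submodule 𝕜 (Ω → 𝕜)) (τ : TopologicalSpace F)
    (hτ : LCLin.IsLCHausdorff 𝕜 τ) (hborn : LCLin.IsBornological 𝕜 τ) :
    List.TFAE [
      LCLin.AdmitsStrongCompleteBarrelledLinearisation.{u, v, w} F τ,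
      LCLin.HasSemiMontelPrebidualWithEvaluations.{u, v, w} F τ,
      ∃ τt : TopologicalSpace F, LCLin.IsLCHausdorff 𝕜 τt ∧ τt ≤ LCLin.pointwiseTopology F ∧
        LCLin.BBC 𝕜 τ τt ∧ LCLin.CNC 𝕜 τ τt ∧
        LCLin.SameBounded 𝕜 τ (LCLin.gammaTilde 𝕜 τ τt),
      ∃ τt : TopologicalSpace F, LCLin.IsLCHausdorff 𝕜 τt ∧ τt ≤ LCLin.pointwiseTopology F ∧
        LCLin.BBCl 𝕜 τ τt ∧ LCLin.CNC 𝕜 τ τt ∧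
        LCLin.IsSemiReflexive 𝕜 (LCLin.gammaTilde 𝕜 τ τt) ∧
        LCLin.SameBounded 𝕜 τ (LCLin.gammaTilde 𝕜 τ τt),
      ∃ τt : TopologicalSpace F, LCLin.IsLCHausdorff 𝕜 τt ∧ τt ≤ LCLin.pointwiseTopology F ∧
        LCLin.BBC 𝕜 τ τt ∧ LCLin.CNC 𝕜 τ τt,
      ∃ τt : TopologicalSpace F, LCLin.IsLCHausdorff 𝕜 τt ∧
        LCLin.BBC 𝕜 τ τt ∧ LCLin.CNC 𝕜 τ τt ∧
        ∀ x : Ω, LCLin.pointEval F x ∈ LCLin.boundedDual 𝕜 τ τt] := by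
  tfae_have 1 → 5 := by
    rintro ⟨Y, _, _, uY, _, hY, -, _, δ, T, hT, hδ⟩
    obtain ⟨τt, h, hB, hC, hc⟩ := LCLin.exists_BBC_CNC_of_barrelledSpace hY T hT
    refine ⟨τt, h, LCLin.le_pointwiseTopology_iff.2 fun x => ?_, hB, hC⟩
    have hx : (LCLin.pointEval F x : F → 𝕜) = fun f => T f (δ x) :=
      funext fun f => (congrFun (hδ f) x).symm
    rw [hx]
    exact hc (δ x)
  tfae_have 5 → 6 := by
    rintro ⟨τt, h, hp, hB, hC⟩
    exact ⟨τt, h, hB, hC, fun x B _ => @Continuous.continuousOn F 𝕜 τt _ _ B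
      (LCLin.le_pointwiseTopology_iff.1 hp x)⟩
  tfae_have 6 → 5 := by
    rintro ⟨τt, h, hB, hC, hx⟩
    -- The join of τ̃ with the pointwise topology agrees with τ̃ on bounded sets, so (BBC) survives;
    -- (CNC) survives any refinement of τ̃.
    refine ⟨_, h.inf_induced F.subtype, inf_le_right, hB.of_induced_eq fun B hB => ?_,
      hC.mono inf_le_left⟩
    refine LCLin.induced_inf_induced_eq τt F.subtype ?_
    let _ := τt
    exact continuousOn_pi.2 fun x => hx x B hB
  tfae_have 5 → 3 := by
    rintro ⟨τt, h, hp, hB, hC⟩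
    exact ⟨τt, h, hp, hB, hC, LCLin.sameBounded_gammaTilde hτ h hB hC⟩
  tfae_have 3 → 2 := by
    rintro ⟨τt, h, hp, hB, hC, hs⟩
    exact LCLin.HasSemiMontelPrebidualWithEvaluations.of_BBC_CNC hτ hborn h hp hB hC hs
  tfae_have 2 → 1 := LCLin.AdmitsStrongCompleteBarrelledLinearisation.of_prebidual
  tfae_have 3 → 4 := by
    rintro ⟨τt, h, hp, hB, hC, hs⟩
    have hγ := (LCLin.isLeast_gammaTilde (𝕜 := 𝕜) τ τt h).1
    refine ⟨τt, h, hp, fun B hBb => ?_, hC, ?_, hs⟩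
    · obtain ⟨C, hBC, hC, hCb, hCc⟩ := hB B hBb
      exact ⟨C, hBC, hC, hCb, @IsCompact.isClosed F τt h.t2Space C hCc⟩
    · let _ := LCLin.gammaTilde 𝕜 τ τt
      have := (hB.of_induced_eq hγ.2).montelSpace hs
      exact LCLin.isSemiReflexive_of_montelSpace hγ.1
  tfae_have 4 → 5 := by
    rintro ⟨τt, h, hp, -, hC, hr, hs⟩
    have hγ := (LCLin.isLeast_gammaTilde (𝕜 := 𝕜) τ τt h).1
    let _ := LCLin.gammaTilde 𝕜 τ τt
    obtain ⟨τ', h', hB', hC', hc⟩ := LCLin.exists_BBC_CNC_of_isSemiReflexive hγ.1 hr hs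
      (hC.mono (LCLin.gammaTilde_le h))
    refine ⟨τ', h', LCLin.le_pointwiseTopology_iff.2 fun x => ?_, hB', hC'⟩
    exact hc _ (LCLin.le_pointwiseTopology_iff.1 ((LCLin.gammaTilde_le h).trans hp) x)
  tfae_finish
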